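/- Let $\mathbb X$ be an effective orbifold of dimension $n\ge 0$ whose underlying space $\mathsf X$ is compact (and Hausdorff). That is, $\mathsf X$ is covered by a family of pairwise compatible orbifold charts $(V,\Gamma,\phi)$, where $V\subset\mathbb R^n$ is open and connected, $\Gamma$ is a finite group acting smoothly and effectively on $V$, and $\phi:V\to\mathsf X$ is $\Gamma$-invariant and induces a homeomorphism of $V/\Gamma$ onto an open subset of $\mathsf X$. An embedding of charts $(V,\Gamma,\phi)\to(V',\Gamma',\phi')$ is a smooth embedding $\psi:V\to V'$ with $\phi'\circ\psi=\phi$ that is equivariant along an injective homomorphism $\Gamma\to\Gamma'$; two charts are compatible if around every point of $\phi(V)\cap\phi'(V')$ there is a chart that embeds into both. The orbifold charts of $\mathbb X$ are all charts on $\mathsf X$ compatible with those of the given family. Let $k\ge 2$ be an integer. Let $C^k(\mathbb X)$ be the set of functions $f:\mathsf X\to\mathbb R$ such that $f_V:=f\circ\phi$ is $C^k$ on $V$ for every orbifold chart $(V,\Gamma,\phi)$ of $\mathbb X$, with the $C^k$-topology (uniform convergence of all derivatives of order $\le k$ of $f_V$ on compact subsets of $V$, for every orbifold chart). Call $f$ Morse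 if, for every orbifold chart $(V,\Gamma,\phi)$ of $\mathbb X$, every critical point of $f_V$ in $V$ is nondegenerate. Then a generic $f\in C^k(\mathbb X)$ is Morse: the set of Morse functions is open and dense in $C^k(\mathbb X)$. -/

import Mathlib

open Set Topology
open scoped ContDiff

universe u

/-- An `n`-dimensional (effective) orbifold chart `(V, Γ, φ)` on a topological space `X`.
The maps `act g` and `φ` are total functions on `ℝⁿ`, but only their values on `V` matter. -/
structure OrbifoldChart (n : ℕ) (X : Type u) [TopologicalSpace X] where
  /-- the domain, a connected open subset of `ℝⁿ` -/
  V : Set (EuclideanSpace ℝ (Fin n))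
  isOpen_V : IsOpen V
  isConnected_V : IsConnected V
  /-- the finite group of the chart -/
  Γ : Type
  [group : Group Γ]
  [finite : Finite Γ]
  /-- the action of `Γ` on `V` -/
  act : Γ → EuclideanSpace ℝ (Fin n) → EuclideanSpace ℝ (Fin n)
  act_mapsTo : ∀ g, MapsTo (act g) V V
  act_one : ∀ x ∈ V, act 1 x = x
  act_mul : ∀ g h, ∀ x ∈ V, act (g * h) x = act g (act h x)
  act_smooth : ∀ g, ContDiffOn ℝ ∞ (act g) V
  act_effective : ∀ g, (∀ x ∈ V, act g x = x) → g = 1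
  /-- the chart map `V → X` -/
  φ : EuclideanSpace ℝ (Fin n) → X
  φ_invariant : ∀ g, ∀ x ∈ V, φ (act g x) = φ x
  /- The next three fields say that the induced map `V / Γ → X` is injective, continuous and open,
  i.e. a homeomorphism onto an open subset of `X`. -/
  φ_injective_mod : ∀ x ∈ V, ∀ y ∈ V, φ x = φ y → ∃ g, act g x = y
  φ_continuous : ContinuousOn φ V
  φ_open : ∀ W, W ⊆ V → IsOpen W → IsOpen (φ '' W)

attribute [instance] OrbifoldChart.group OrbifoldChart.finite

namespace OrbifoldChart

variable {n : ℕ} {X : Type u} [TopologicalSpace X]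

/-- The open subset of `X` that is uniformized by the chart. -/
def image (c : OrbifoldChart n X) : Set X := c.φ '' c.V

/-- An embedding of orbifold charts `(ψ, θ) : (V, Γ, φ) → (V', Γ', φ')`: a smooth embedding
`ψ : V → V'` over `X`, equivariant along an injective group homomorphism `θ : Γ → Γ'`. -/
structure Embedding (c c' : OrbifoldChart n X) where
  ψ : EuclideanSpace ℝ (Fin n) → EuclideanSpace ℝ (Fin n)
  ψ_mapsTo : MapsTo ψ c.V c'.V
  ψ_smooth : ContDiffOn ℝ ∞ ψ c.V
  ψ_immersion : ∀ x ∈ c.V, Function.Injective (fderiv ℝ ψ x)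
  ψ_embedding : IsEmbedding (fun x : c.V => ψ x)
  φ_comp : ∀ x ∈ c.V, c'.φ (ψ x) = c.φ x
  θ : c.Γ →* c'.Γ
  θ_injective : Function.Injective θ
  ψ_equivariant : ∀ g, ∀ x ∈ c.V, ψ (c.act g x) = c'.act (θ g) (ψ x)

/-- Two charts are compatible if around every point of the intersection of their images there is
a chart that embeds into both of them. -/
def Compatible (c c' : OrbifoldChart n X) : Prop :=
  ∀ x ∈ c.image ∩ c'.image, ∃ w : OrbifoldChart n X, x ∈ w.image ∧
    Nonempty (w.Embedding c) ∧ Nonempty (w.Embedding c')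

end OrbifoldChart

/-- An effective `n`-dimensional orbifold structure on the topological space `X`, given by an
orbifold atlas: a family of pairwise compatible orbifold charts that covers `X`. -/
structure Orbifold (n : ℕ) (X : Type u) [TopologicalSpace X] where
  atlas : Set (OrbifoldChart n X)
  covers : ∀ x : X, ∃ c ∈ atlas, x ∈ c.image
  compatible : ∀ c ∈ atlas, ∀ c' ∈ atlas, c.Compatible c'

/-- `IsNondegenerateOn g V`: every critical point of `g` in the open set `V` has a nondegenerate
Hessian. -/
def IsNondegenerateOn {n : ℕ} (g : EuclideanSpace ℝ (Fin n) → ℝ)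
    (V : Set (EuclideanSpace ℝ (Fin n))) : Prop :=
  ∀ x ∈ V, fderiv ℝ g x = 0 →
    ∀ v, (∀ w, fderiv ℝ (fderiv ℝ g) x v w = 0) → v = 0

/-- `g` restricts to a Morse function on the open set `V`: it is `C²` on `V` and all its critical
points in `V` are nondegenerate. -/
def IsMorseOn {n : ℕ} (g : EuclideanSpace ℝ (Fin n) → ℝ)
    (V : Set (EuclideanSpace ℝ (Fin n))) : Prop :=
  ContDiffOn ℝ 2 g V ∧ IsNondegenerateOn g V

namespace Orbifold

variable {n : ℕ} {X : Type u} [TopologicalSpace X]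

/-- The orbifold charts of `𝕏`: the maximal atlas, which consists of all charts on `X` that are
compatible with the charts of the given atlas. -/
def charts (𝕏 : Orbifold n X) : Set (OrbifoldChart n X) :=
  {c | ∀ c' ∈ 𝕏.atlas, c.Compatible c'}

/-- A `C^k`-function on the orbifold: every local representative `f_V = f ∘ φ` is `C^k` on `V`. -/
structure CkFunction (𝕏 : Orbifold n X) (k : ℕ) where
  toFun : X → ℝ
  contDiffOn : ∀ c ∈ 𝕏.charts, ContDiffOn ℝ k (toFun ∘ c.φ) c.V

/-- The `C^k`-topology: uniform convergence, on the compact subsets of `V` for every orbifold chart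
`(V, Γ, φ)`, of all derivatives of order at most `k` of the local representatives. -/
noncomputable instance instTopologicalSpaceCkFunction (𝕏 : Orbifold n X) (k : ℕ) : TopologicalSpace (𝕏.CkFunction k) :=
  ⨅ c ∈ 𝕏.charts, ⨅ i ∈ Finset.range (k + 1),
    TopologicalSpace.induced
      (fun f : 𝕏.CkFunction k =>
        UniformOnFun.ofFun {K | IsCompact K ∧ K ⊆ c.V} (iteratedFDeriv ℝ i (f.toFun ∘ c.φ)))
      inferInstance

/-- A function on the orbifold is Morse if its local representative in every orbifold chart is a
Morse function. -/
def IsMorse (𝕏 : Orbifold n X) (f : X → ℝ) : Prop :=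
  ∀ c ∈ 𝕏.charts, IsMorseOn (f ∘ c.φ) c.V

end Orbifold

/-! Openness. Being nondegenerate on a compact set K of a chart means that the 2-jet of f maps K
into the complement of a closed set, `isClosed_degenerateJets`. This survives perturbations that are
C²-small on K. Nondegeneracy is preserved by transition maps, and X is covered by the images of
finitely many such K. The Morse functions are therefore a finite intersection of these open sets,
and it remains to show that each of them is dense.

Density on K is proved stratum by stratum, by descending induction on the order of the isotropy
group (`dense_nondegenerateSet_le_isotropyOrder`). Near a point x, the points whose isotropy is as
large as that of x are fixed by Γ_x. Averaging linearizes the action of Γ_x, so these points form a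
linear subspace F (`exists_slice`). Two small perturbations then suffice. A generic linear
functional on F, extended by averaging, makes f restricted to F Morse, by the equal-dimensional Sard
theorem. Invariance makes F and its normal directions orthogonal for the Hessian, so only the normal
block can still degenerate, and only at the finitely many critical points on F in a compact ball.
Adding s times an invariant normal quadratic form repairs this for all but finitely many s. Cut off
and averaged over Γ, both perturbations descend to X. -/

/-! ### Hessians, change of variables and linear perturbations. -/

section Calculus

variable {E F : Type*} [NormedAddCommGroup E] [NormedSpace ℝ E]
  [NormedAddCommGroup F] [NormedSpace ℝ F]

/-- If `x` is a critical point of `g`, then the Hessian of `g` at `x` is nondegenerate. -/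
def NondegenerateAt (g : E → ℝ) (x : E) : Prop :=
  fderiv ℝ g x = 0 → ∀ v, (∀ w, fderiv ℝ (fderiv ℝ g) x v w = 0) → v = 0

theorem NondegenerateAt.congr {g h : E → ℝ} {x : E} (hg : NondegenerateAt g x)
    (hgh : h =ᶠ[𝓝 x] g) : NondegenerateAt h x := by
  unfold NondegenerateAt
  rw [hgh.fderiv_eq, hgh.fderiv.fderiv_eq]
  exact hg

theorem ContDiffAt.differentiableAt_fderiv {g : E → F} {x : E} (hg : ContDiffAt ℝ 2 g x) :
    DifferentiableAt ℝ (fderiv ℝ g) x :=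
  (hg.fderiv_right (m := 1) (by norm_num [one_add_one_eq_two])).differentiableAt (by simp)

theorem ContDiffAt.eventually_differentiableAt {g : E → F} {x : E} (hg : ContDiffAt ℝ 2 g x) :
    ∀ᶠ y in 𝓝 x, DifferentiableAt ℝ g y :=
  (hg.eventually (by decide)).mono fun _ hy => hy.differentiableAt (by simp)

theorem hessian_comp {g : F → ℝ} {T : E → F} {x : E} (hg : ContDiffAt ℝ 2 g (T x))
    (hT : ContDiffAt ℝ 2 T x) (v w : E) :
    fderiv ℝ (fderiv ℝ (g ∘ T)) x v w =
      fderiv ℝ (fderiv ℝ g) (T x) (fderiv ℝ T x v) (fderiv ℝ T x w) +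
        fderiv ℝ g (T x) (fderiv ℝ (fderiv ℝ T) x v w) := by
  have hev : fderiv ℝ (g ∘ T) =ᶠ[𝓝 x] fun y => (fderiv ℝ g (T y)).comp (fderiv ℝ T y) := by
    filter_upwards [hT.eventually_differentiableAt,
      hT.continuousAt.eventually hg.eventually_differentiableAt] with y h1 h2
    exact fderiv_comp y h2 h1
  have h1 : HasFDerivAt (fun y => fderiv ℝ g (T y))
      ((fderiv ℝ (fderiv ℝ g) (T x)).comp (fderiv ℝ T x)) x :=
    hg.differentiableAt_fderiv.hasFDerivAt.comp x (hT.differentiableAt (by simp)).hasFDerivAt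
  have h2 := h1.clm_comp hT.differentiableAt_fderiv.hasFDerivAt
  rw [hev.fderiv_eq, h2.fderiv]
  simp [add_comm]

/-- At a critical point the second-order term of `hessian_comp` drops out, so the Hessian transforms
as a bilinear form under dT, which is bijective because it is injective in finite dimension. -/
theorem NondegenerateAt.of_comp [FiniteDimensional ℝ E] {g : E → ℝ} {T : E → E} {x : E}
    (hg : ContDiffAt ℝ 2 g (T x)) (hT : ContDiffAt ℝ 2 T x)
    (hinj : Function.Injective (fderiv ℝ T x)) (h : NondegenerateAt (g ∘ T) x) :
    NondegenerateAt g (T x) := by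
  intro h0 v hv
  obtain ⟨v', rfl⟩ :=
    (LinearMap.injective_iff_surjective (f := (fderiv ℝ T x).toLinearMap)).1 hinj v
  have h1 : fderiv ℝ (g ∘ T) x = 0 := by
    rw [fderiv_comp x (hg.differentiableAt (by simp)) (hT.differentiableAt (by simp)), h0]
    simp
  have h2 : v' = 0 := h h1 v' fun w => by
    rw [hessian_comp hg hT, h0]
    simpa using hv _
  simp [h2]

theorem NondegenerateAt.comp [FiniteDimensional ℝ E] {g : E → ℝ} {T : E → E} {x : E}
    (hg : ContDiffAt ℝ 2 g (T x)) (hT : ContDiffAt ℝ 2 T x)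
    (hinj : Function.Injective (fderiv ℝ T x)) (h : NondegenerateAt g (T x)) :
    NondegenerateAt (g ∘ T) x := by
  intro h0 v hv
  have hsurj := (LinearMap.injective_iff_surjective (f := (fderiv ℝ T x).toLinearMap)).1 hinj
  rw [fderiv_comp x (hg.differentiableAt (by simp)) (hT.differentiableAt (by simp))] at h0
  have h1 : fderiv ℝ g (T x) = 0 := by
    ext w
    obtain ⟨w', rfl⟩ := hsurj w
    exact DFunLike.congr_fun h0 w'
  refine hinj ((h h1 _ fun w => ?_).trans (map_zero _).symm)
  obtain ⟨w', rfl⟩ := hsurj w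
  have := hv w'
  rw [hessian_comp hg hT, h1] at this
  simpa using this

theorem hessian_add {g h : E → ℝ} {x : E} (hg : ContDiffAt ℝ 2 g x) (hh : ContDiffAt ℝ 2 h x) :
    fderiv ℝ (fderiv ℝ (fun y => g y + h y)) x =
      fderiv ℝ (fderiv ℝ g) x + fderiv ℝ (fderiv ℝ h) x := by
  have hev : fderiv ℝ (fun y => g y + h y) =ᶠ[𝓝 x] fun y => fderiv ℝ g y + fderiv ℝ h y := by
    filter_upwards [hg.eventually_differentiableAt, hh.eventually_differentiableAt] with y h1 h2
    exact fderiv_fun_add h1 h2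
  rw [hev.fderiv_eq, fderiv_fun_add hg.differentiableAt_fderiv hh.differentiableAt_fderiv]

/-- A generic linear perturbation of a `C²`-function has only nondegenerate critical points. -/
theorem exists_inner_perturbation_nondegenerateAt {E : Type*} [NormedAddCommGroup E]
    [InnerProductSpace ℝ E] [FiniteDimensional ℝ E] {g : E → ℝ} {U : Set E}
    (hg : ∀ z ∈ U, ContDiffAt ℝ 2 g z) {ε : ℝ} (hε : 0 < ε) :
    ∃ a : E, ‖a‖ < ε ∧ ∀ z ∈ U, NondegenerateAt (fun y => g y + inner ℝ a y) z := by
  let _ : MeasurableSpace E := borel E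
  have _ : BorelSpace E := ⟨rfl⟩
  let J : StrongDual ℝ E →L[ℝ] E :=
    { toFun := (InnerProductSpace.toDual ℝ E).symm
      map_add' := map_add _
      map_smul' := fun c L => by simp
      cont := (InnerProductSpace.toDual ℝ E).symm.continuous }
  have hJ : ∀ L v, inner ℝ (J L) v = L v := fun L v => by
    simp [J]
  let S : Set E := {z ∈ U | ∃ v ≠ 0, ∀ w, fderiv ℝ (fderiv ℝ g) z v w = 0}
  -- If z is critical for g + ⟪a, ·⟫ then a = -∇g(z), and z is degenerate exactly when the
  -- derivative of -∇g at z is singular. So the bad a are critical values of -∇g. Sard's theorem in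
  -- equal dimensions only needs this map to be differentiable, hence g to be C².
  have hzero : (MeasureTheory.volume : MeasureTheory.Measure E)
      ((fun z => -J (fderiv ℝ g z)) '' S) = 0 := by
    refine MeasureTheory.addHaar_image_eq_zero_of_det_fderivWithin_eq_zero _
      (f' := fun z => -(J.comp (fderiv ℝ (fderiv ℝ g) z))) ?_ ?_
    · intro z hz
      exact ((J.hasFDerivAt.comp z
        (hg z hz.1).differentiableAt_fderiv.hasFDerivAt).neg).hasFDerivWithinAt
    · rintro z ⟨-, v, hv, hw⟩
      by_contra hdet
      refine hv ?_
      have hinj := (LinearMap.equivOfDetNeZero _ hdet).injective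
      apply hinj
      simp [LinearMap.equivOfDetNeZero]
      have : fderiv ℝ (fderiv ℝ g) z v = 0 := by ext w; exact hw w
      simp [this]
  have hball : ¬ Metric.ball (0 : E) ε ⊆ (fun z => -J (fderiv ℝ g z)) '' S := fun hsub =>
    (Metric.measure_ball_pos MeasureTheory.volume (0 : E) hε).ne'
      (MeasureTheory.measure_mono_null hsub hzero)
  obtain ⟨a, ha, haS⟩ := not_subset.1 hball
  refine ⟨a, by simpa using ha, fun z hz h0 v hv => ?_⟩
  have hlin : ContDiffAt ℝ 2 (fun y => inner ℝ a y) z := (innerSL ℝ a).contDiff.contDiffAt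
  have hd : ∀ y, fderiv ℝ (fun y => inner ℝ a y) y = innerSL ℝ a := fun y =>
    (innerSL ℝ a).fderiv
  rw [fderiv_fun_add ((hg z hz).differentiableAt (by simp)) (hlin.differentiableAt (by simp)),
    hd] at h0
  by_contra hv0
  refine haS ⟨z, ⟨hz, v, hv0, fun w => ?_⟩, ?_⟩
  · have := hv w
    rw [hessian_add (hg z hz) hlin, funext hd] at this
    simpa using this
  · refine ext_inner_right ℝ fun w => ?_
    have := DFunLike.congr_fun h0 w
    simp only [inner_neg_left, hJ]
    simp at this
    linarith

end Calculus

/-! ### Isolation of critical points, and pencils of bilinear forms. -/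

section CriticalPoints

variable {E : Type*} [NormedAddCommGroup E] [NormedSpace ℝ E] [FiniteDimensional ℝ E]

/-- Infinitely many critical points would accumulate in K. At a noncritical point this contradicts
continuity of the derivative; at a critical one the injective Hessian makes the zero of the
derivative isolated. -/
theorem finite_criticalPoints_of_nondegenerateAt {g : E → ℝ} {K : Set E} (hK : IsCompact K)
    (hg : ∀ z ∈ K, ContDiffAt ℝ 2 g z) (hnd : ∀ z ∈ K, NondegenerateAt g z) :
    {z ∈ K | fderiv ℝ g z = 0}.Finite := by
  by_contra hinf
  obtain ⟨z, hz, hacc⟩ := Set.Infinite.exists_accPt_of_subset_isCompact hinf hK (sep_subset _ _)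
  rw [accPt_iff_frequently] at hacc
  have hd := (hg z hz).differentiableAt_fderiv
  by_cases h0 : fderiv ℝ g z = 0
  · have hinj : Function.Injective (fderiv ℝ (fderiv ℝ g) z) := by
      rw [injective_iff_map_eq_zero]
      exact fun v hv => hnd z hz h0 v fun w => by rw [hv]; rfl
    obtain ⟨C, -, hC⟩ := (fderiv ℝ (fderiv ℝ g) z).toLinearMap.exists_antilipschitzWith
      (LinearMap.ker_eq_bot.2 hinj)
    have hne := hd.hasFDerivAt.eventually_ne (c := 0) ⟨C, hC⟩
    rw [eventually_nhdsWithin_iff] at hne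
    obtain ⟨y, ⟨hy1, hy2⟩, hy3⟩ := (hacc.and_eventually hne).exists
    exact hy3 hy1 hy2.2
  · obtain ⟨y, hy1, hy2⟩ := (hacc.and_eventually (hd.continuousAt.eventually_ne h0)).exists
    exact hy2 hy1.2.2

/-- B is invertible by equality of dimensions, so the exceptional s are the negatives of eigenvalues
of B⁻¹M. -/
theorem finite_setOf_exists_add_smul_eq_zero (M B : E →L[ℝ] StrongDual ℝ E)
    (hB : Function.Injective B) : {s : ℝ | ∃ v ≠ 0, M v + s • B v = 0}.Finite := by
  have hrank : Module.finrank ℝ E = Module.finrank ℝ (StrongDual ℝ E) := by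
    rw [← (LinearMap.toContinuousLinearMap (𝕜 := ℝ) (E := E) (F' := ℝ)).finrank_eq]
    exact (Subspace.dual_finrank_eq (K := ℝ) (V := E)).symm
  let e := LinearMap.linearEquivOfInjective B.toLinearMap hB hrank
  have he : ∀ v, e v = B v := fun v => by simp [e]
  let T : Module.End ℝ E := e.symm.toLinearMap ∘ₗ M.toLinearMap
  refine ((Module.End.finite_hasEigenvalue T).preimage (f := fun s : ℝ => -s)
    neg_injective.injOn).subset ?_
  rintro s ⟨v, hv, h⟩
  refine Module.End.hasEigenvalue_of_hasEigenvector (x := v)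
    ⟨Module.End.mem_eigenspace_iff.2 ?_, hv⟩
  simp only [T, LinearMap.comp_apply, ContinuousLinearMap.coe_coe, LinearEquiv.coe_coe]
  rw [LinearEquiv.symm_apply_eq, map_smul, he]
  exact (eq_neg_of_add_eq_zero_left h).trans (neg_smul s (B v)).symm

end CriticalPoints

/-! ### Invariant functions on a linear representation. -/

namespace LinearRep

variable {E : Type*} [NormedAddCommGroup E] [InnerProductSpace ℝ E]
  {H : Type*} [Group H] (A : H →* (E →L[ℝ] E))

/-- The subspace of vectors fixed by a linear action. -/
def fixed : Submodule ℝ E where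
  carrier := {z | ∀ h, A h z = z}
  add_mem' := fun hx hy h => by rw [map_add, hx h, hy h]
  zero_mem' := fun h => map_zero _
  smul_mem' := fun c x hx h => by rw [map_smul, hx h]

/-- Differentiate G ∘ A h = G twice at a fixed point; A h is linear and contributes no second-order
term. -/
theorem hessian_apply_apply {G : E → ℝ} {z : E} (hz : z ∈ fixed A)
    (hG : ContDiffAt ℝ 2 G z) (hinv : ∀ h, (fun y => G (A h y)) =ᶠ[𝓝 z] G) (h : H) (v w : E) :
    fderiv ℝ (fderiv ℝ G) z (A h v) (A h w) = fderiv ℝ (fderiv ℝ G) z v w := by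
  have hG' : ContDiffAt ℝ 2 G (A h z) := by rwa [hz h]
  have h1 := hessian_comp hG' (A h).contDiff.contDiffAt v w
  have h2 : fderiv ℝ (fderiv ℝ (A h)) z = 0 := by
    rw [show fderiv ℝ (A h) = fun _ => A h from funext fun _ => (A h).fderiv]
    simp
  have h3 : G ∘ A h =ᶠ[𝓝 z] G := hinv h
  rw [h3.fderiv.fderiv_eq, h2, hz h, (A h).fderiv] at h1
  simpa using h1.symm

variable [Fintype H]

/-- The projection to the fixed subspace given by averaging over the group. -/
noncomputable def avg : E →L[ℝ] E := (Fintype.card H : ℝ)⁻¹ • ∑ h, A h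

theorem avg_apply (z : E) : avg A z = (Fintype.card H : ℝ)⁻¹ • ∑ h, A h z := by
  simp [avg]

theorem avg_mem_fixed (z : E) : avg A z ∈ fixed A := fun h => by
  rw [avg_apply, map_smul, map_sum]
  congr 1
  simp_rw [← mul_apply_eq_comp, ← map_mul]
  exact Fintype.sum_equiv (Equiv.mulLeft h) _ _ fun _ => rfl

theorem avg_of_mem_fixed {z : E} (hz : z ∈ fixed A) : avg A z = z := by
  have hz' : ∀ h, A h z = z := hz
  rw [avg_apply]
  simp_rw [hz']
  rw [Finset.sum_const, Finset.card_univ, ← Nat.cast_smul_eq_nsmul ℝ,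
    inv_smul_smul₀ (by exact_mod_cast Fintype.card_ne_zero)]

/-- The invariant symmetric bilinear form `∑ ⟪(1 - P) A h v, (1 - P) A h w⟫`, where `P` is the
averaging projection. -/
noncomputable def normalBilin : E →L[ℝ] StrongDual ℝ E :=
  ∑ h, (innerSL ℝ).bilinearComp ((1 - avg A).comp (A h)) ((1 - avg A).comp (A h))

theorem normalBilin_apply (v w : E) : normalBilin A v w =
    ∑ h, inner ℝ (A h v - avg A (A h v)) (A h w - avg A (A h w)) := by
  simp [normalBilin, inner_sub_left]

theorem normalBilin_comm (v w : E) : normalBilin A v w = normalBilin A w v := by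
  simp only [normalBilin_apply]
  exact Finset.sum_congr rfl fun h _ => real_inner_comm _ _

theorem normalBilin_of_mem_fixed {z : E} (hz : z ∈ fixed A) : normalBilin A z = 0 := by
  ext w
  rw [normalBilin_apply]
  refine Finset.sum_eq_zero fun h _ => ?_
  rw [hz h, avg_of_mem_fixed A hz]
  simp

/-- The quadratic function of `normalBilin`; it is constant in the direction of the fixed
subspace. -/
noncomputable def normalSq (z : E) : ℝ := ∑ h, 2⁻¹ * ‖A h z - avg A (A h z)‖ ^ 2

theorem normalSq_eq (z : E) : normalSq A z = 2⁻¹ * normalBilin A z z := by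
  rw [normalSq, normalBilin_apply, Finset.mul_sum]
  simp

theorem contDiff_normalSq {m : WithTop ℕ∞} : ContDiff ℝ m (normalSq A) := by
  rw [funext (normalSq_eq A)]
  fun_prop

theorem fderiv_normalSq (z : E) : fderiv ℝ (normalSq A) z = normalBilin A z := by
  rw [funext (normalSq_eq A)]
  have h1 : HasFDerivAt (fun z => normalBilin A z z) _ z :=
    (normalBilin A).hasFDerivAt.clm_apply (hasFDerivAt_id z)
  rw [(h1.const_mul 2⁻¹).fderiv]
  ext w
  simp [normalBilin_comm A w z]
  ring

/-- This is the block decomposition: vectors with zero average are Hessian-orthogonal to the fixed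
subspace. -/
theorem hessian_avg {G : E → ℝ} {z : E} (hz : z ∈ fixed A)
    (hG : ContDiffAt ℝ 2 G z) (hinv : ∀ h, (fun y => G (A h y)) =ᶠ[𝓝 z] G) (v : E) {w : E}
    (hw : w ∈ fixed A) :
    fderiv ℝ (fderiv ℝ G) z (avg A v) w = fderiv ℝ (fderiv ℝ G) z v w := by
  have : ∀ h, fderiv ℝ (fderiv ℝ G) z (A h v) w = fderiv ℝ (fderiv ℝ G) z v w := fun h => by
    have := hessian_apply_apply A hz hG hinv h v w
    rwa [hw h] at this
  rw [avg_apply, map_smul, map_sum, smul_apply,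
    _root_.sum_apply, Finset.sum_congr rfl fun h _ => this h]
  simp

/-- The bilinear form `⟪P v, P w⟫`, where `P` is the averaging projection. -/
noncomputable def tangentBilin : E →L[ℝ] StrongDual ℝ E :=
  (innerSL ℝ).bilinearComp (avg A) (avg A)

theorem tangentBilin_apply (v w : E) : tangentBilin A v w = inner ℝ (avg A v) (avg A w) := rfl

/-- The form is positive definite: if its value at (v, v) vanishes, so do P v and, from the summand
h = 1, v - P v. -/
theorem injective_normalBilin_add_tangentBilin :
    Function.Injective (normalBilin A + tangentBilin A) := by
  rw [injective_iff_map_eq_zero]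
  intro v hv
  have h1 := DFunLike.congr_fun hv v
  simp only [_root_.add_apply, normalBilin_apply, tangentBilin_apply,
    real_inner_self_eq_norm_sq, _root_.zero_apply] at h1
  have h2 : 0 ≤ ∑ h, ‖A h v - avg A (A h v)‖ ^ 2 := by positivity
  have h3 : ‖avg A v‖ ^ 2 = 0 := by nlinarith [sq_nonneg ‖avg A v‖]
  have h4 : ∑ h, ‖A h v - avg A (A h v)‖ ^ 2 = 0 := by linarith
  have h5 := (Finset.sum_eq_zero_iff_of_nonneg fun h _ => by positivity).1 h4 1 (Finset.mem_univ _)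
  have h6 : avg A v = 0 := by simpa using h3
  simpa [h6] using h5

/-- Averages of generic small linear functionals make an invariant function nondegenerate along
the fixed subspace. -/
theorem exists_linear_perturbation [FiniteDimensional ℝ E] {G : E → ℝ} {U : Set E}
    (hG : ∀ z ∈ U, ContDiffAt ℝ 2 G z) {ε : ℝ} (hε : 0 < ε) :
    ∃ a : E, ‖a‖ < ε ∧ ∀ z : fixed A, (z : E) ∈ U →
      NondegenerateAt (fun y : fixed A => G y + ∑ h, inner ℝ a (A h y)) z := by
  have hc : (1 : ℝ) ≤ Fintype.card H := by exact_mod_cast Fintype.card_pos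
  obtain ⟨a, ha, hnd⟩ := exists_inner_perturbation_nondegenerateAt (g := fun y : fixed A => G y)
    (U := {z | (z : E) ∈ U})
    (fun z hz => (hG z hz).comp z (fixed A).subtypeL.contDiff.contDiffAt) hε
  -- On fixed vectors the sum over H multiplies the functional by |H|; the factor cancels this and
  -- does not increase the norm.
  refine ⟨(Fintype.card H : ℝ)⁻¹ • (a : E), ?_, fun z hz => ?_⟩
  · rw [norm_smul, norm_inv, Real.norm_natCast]
    refine lt_of_le_of_lt ?_ ha
    exact mul_le_of_le_one_left (norm_nonneg _) (inv_le_one_of_one_le₀ hc)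
  · refine (hnd z hz).congr (Filter.Eventually.of_forall fun y => ?_)
    have : ∀ h, A h (y : E) = y := y.2
    simp only [this, inner_smul_left, Finset.sum_const, Finset.card_univ, nsmul_eq_mul]
    simp

/-- If an invariant function is nondegenerate along the fixed subspace, then adding a generic
multiple of `normalSq` makes it nondegenerate at the points of a compact set that are fixed. -/
theorem finite_not_nondegenerateAt_add_normalSq [FiniteDimensional ℝ E] {G : E → ℝ} {K : Set E}
    (hK : IsCompact K) (hG : ∀ z ∈ K, ContDiffAt ℝ 2 G z)
    (hinv : ∀ z ∈ K, ∀ h, (fun y => G (A h y)) =ᶠ[𝓝 z] G)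
    (hnd : ∀ z : fixed A, (z : E) ∈ K → NondegenerateAt (fun y : fixed A => G y) z) :
    {s : ℝ | ¬ ∀ z ∈ K, z ∈ fixed A →
      NondegenerateAt (fun y => G y + s * normalSq A y) z}.Finite := by
  have hsub : ∀ z : fixed A, fderiv ℝ ((fixed A).subtypeL) z = (fixed A).subtypeL := fun z =>
    (fixed A).subtypeL.fderiv
  have hsmooth : ∀ z : fixed A, ContDiffAt ℝ 2 (fixed A).subtypeL z := fun z =>
    (fixed A).subtypeL.contDiff.contDiffAt
  have hfin := finite_criticalPoints_of_nondegenerateAt (g := fun y : fixed A => G y)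
    (K := {z | (z : E) ∈ K})
    ((fixed A).closed_of_finiteDimensional.isClosedEmbedding_subtypeVal.isCompact_preimage hK)
    (fun z hz => (hG z hz).comp z (hsmooth z)) hnd
  refine (hfin.biUnion fun z _ => finite_setOf_exists_add_smul_eq_zero
    (fderiv ℝ (fderiv ℝ G) z) _ (injective_normalBilin_add_tangentBilin A)).subset ?_
  intro s hs
  simp only [mem_ofPred_eq, not_forall] at hs
  obtain ⟨z, hzK, hz, hs⟩ := hs
  simp only [NondegenerateAt, not_forall] at hs
  obtain ⟨h0, v, hv, hv0⟩ := hs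
  have hsq : ContDiffAt ℝ 2 (fun y => s * normalSq A y) z :=
    (contDiff_const.mul (contDiff_normalSq A)).contDiffAt
  have hdsq : fderiv ℝ (fun y => s * normalSq A y) = fun y => (s • normalBilin A) y := by
    funext y
    rw [fderiv_const_mul ((contDiff_normalSq A (m := 1)).differentiable (by simp) y),
      fderiv_normalSq]
    rfl
  rw [fderiv_fun_add ((hG z hzK).differentiableAt (by simp)) (hsq.differentiableAt (by simp)),
    hdsq] at h0
  simp only [smul_apply, normalBilin_of_mem_fixed A hz, smul_zero, add_zero] at h0
  rw [hessian_add (hG z hzK) hsq, hdsq, (s • normalBilin A).fderiv] at hv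
  have hcrit : fderiv ℝ (fun y : fixed A => G y) ⟨z, hz⟩ = 0 := by
    have := fderiv_comp (⟨z, hz⟩ : fixed A) ((hG z hzK).differentiableAt (by simp))
      ((hsmooth ⟨z, hz⟩).differentiableAt (by simp))
    refine this.trans ?_
    change (fderiv ℝ G z).comp _ = 0
    rw [h0]
    simp
  -- Test v against fixed w: the `normalBilin` term vanishes and `hessian_avg` replaces v by P v,
  -- which is thus in the kernel of the nondegenerate Hessian along F.
  have hPv : avg A v = 0 := by
    have := hnd ⟨z, hz⟩ hzK hcrit ⟨avg A v, avg_mem_fixed A v⟩ fun w => by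
      have h1 := hessian_comp (T := (fixed A).subtypeL) (x := ⟨z, hz⟩) (hG z hzK)
        (hsmooth ⟨z, hz⟩) ⟨avg A v, avg_mem_fixed A v⟩ w
      refine h1.trans ?_
      change fderiv ℝ (fderiv ℝ G) z _ _ + fderiv ℝ G z _ = 0
      rw [h0, hsub]
      have h2 := hv w
      rw [_root_.add_apply, _root_.add_apply, smul_apply, smul_apply, normalBilin_comm,
        normalBilin_of_mem_fixed A w.2] at h2
      have h3 := hessian_avg A hz (hG z hzK) (hinv z hzK) v w.2
      simpa [h3] using h2
    exact congrArg Subtype.val this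
  simp only [mem_iUnion, mem_ofPred_eq]
  -- As P v = 0, the term `tangentBilin` can be added for free. It makes the second form of the
  -- pencil injective.
  refine ⟨⟨z, hz⟩, ⟨hzK, hcrit⟩, v, hv0, ?_⟩
  ext w
  simpa [tangentBilin_apply, hPv] using hv w

end LinearRep

/-! ### The closed set of degenerate 2-jets. -/

section Jets

variable {E : Type*} [NormedAddCommGroup E] [NormedSpace ℝ E]

theorem nondegenerateAt_iff_iteratedFDeriv {g : E → ℝ} {x : E} :
    NondegenerateAt g x ↔ (iteratedFDeriv ℝ 1 g x = 0 →
      ∀ v, (∀ w, iteratedFDeriv ℝ 2 g x ![v, w] = 0) → v = 0) := by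
  have h1 : iteratedFDeriv ℝ 1 g x = 0 ↔ fderiv ℝ g x = 0 := by
    constructor
    · intro h
      ext v
      simpa using DFunLike.congr_fun h ![v]
    · intro h
      ext m
      simp [h]
  simp [NondegenerateAt, h1, iteratedFDeriv_two_apply]

/-- The pairs of first and second derivatives that occur at degenerate critical points. -/
def degenerateJets (E : Type*) [NormedAddCommGroup E] [NormedSpace ℝ E] :
    Set ((E [×1]→L[ℝ] ℝ) × (E [×2]→L[ℝ] ℝ)) :=
  {p | p.1 = 0 ∧ ∃ v ∈ Metric.sphere (0 : E) 1, ∀ w, p.2 ![v, w] = 0}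

theorem nondegenerateAt_iff_notMem_degenerateJets {g : E → ℝ} {x : E} :
    NondegenerateAt g x ↔
      (iteratedFDeriv ℝ 1 g x, iteratedFDeriv ℝ 2 g x) ∉ degenerateJets E := by
  rw [nondegenerateAt_iff_iteratedFDeriv]
  constructor
  · rintro h ⟨h0, v, hv, hw⟩
    have := h h0 v hw
    simp [this] at hv
  · intro h h0 v hv
    by_contra hv0
    refine h ⟨h0, ‖v‖⁻¹ • v, by simp [norm_smul, hv0], fun w => ?_⟩
    have := hv w
    simp only [iteratedFDeriv_two_apply] at this ⊢
    simpa [hv0] using this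

/-- Normalizing the null vector to the unit sphere exhibits this set as the projection of a closed
set along a compact factor. -/
theorem isClosed_degenerateJets [FiniteDimensional ℝ E] : IsClosed (degenerateJets E) := by
  have hsph : IsCompact (Metric.sphere (0 : E) 1) := isCompact_sphere 0 1
  have : CompactSpace (Metric.sphere (0 : E) 1) := isCompact_iff_compactSpace.1 hsph
  let C : Set (((E [×1]→L[ℝ] ℝ) × (E [×2]→L[ℝ] ℝ)) × Metric.sphere (0 : E) 1) :=
    {q | q.1.1 = 0 ∧ ∀ w, q.1.2 ![(q.2 : E), w] = 0}
  have hC : IsClosed C := by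
    have hw : ∀ w : E, IsClosed {q : ((E [×1]→L[ℝ] ℝ) × (E [×2]→L[ℝ] ℝ)) ×
        Metric.sphere (0 : E) 1 | q.1.2 ![(q.2 : E), w] = 0} := fun w => by
      have hv : Continuous fun q : ((E [×1]→L[ℝ] ℝ) × (E [×2]→L[ℝ] ℝ)) ×
          Metric.sphere (0 : E) 1 => ![(q.2 : E), w] := by fun_prop
      exact isClosed_eq (by fun_prop) continuous_const
    have heq : C = {q | q.1.1 = 0} ∩ ⋂ w : E, {q | q.1.2 ![(q.2 : E), w] = 0} := by
      ext q
      simp [C]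
    rw [heq]
    exact (isClosed_eq (by fun_prop) continuous_const).inter (isClosed_iInter hw)
  have := isClosedMap_fst_of_compactSpace _ hC
  convert this using 1
  ext p
  simp [C, degenerateJets]

end Jets

/-! ### The C^k-topology and finite-dimensional perturbations. -/

namespace Orbifold

variable {n : ℕ} {X : Type u} [TopologicalSpace X] {𝕏 : Orbifold n X} {k : ℕ}

theorem atlas_subset_charts : 𝕏.atlas ⊆ 𝕏.charts := 𝕏.compatible

theorem tendsto_ckFunction_iff {ι : Type*} {l : Filter ι} {F : ι → 𝕏.CkFunction k}
    {f : 𝕏.CkFunction k} :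
    Filter.Tendsto F l (𝓝 f) ↔ ∀ c ∈ 𝕏.charts, ∀ i ≤ k, ∀ K, IsCompact K → K ⊆ c.V →
      TendstoUniformlyOn (fun t => iteratedFDeriv ℝ i ((F t).toFun ∘ c.φ))
        (iteratedFDeriv ℝ i (f.toFun ∘ c.φ)) l K := by
  simp only [nhds_iInf, nhds_induced, Filter.tendsto_iInf,
    Filter.tendsto_comap_iff, UniformOnFun.tendsto_iff_tendstoUniformlyOn, Finset.mem_range,
    Nat.lt_succ_iff]
  exact ⟨fun h c hc i hi K hK hKV => h c hc i hi K ⟨hK, hKV⟩,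
    fun h c hc i hi K hK => h c hc i hi K hK.1 hK.2⟩

theorem CkFunction.contDiffAt (f : 𝕏.CkFunction k) {c : OrbifoldChart n X} (hc : c ∈ 𝕏.charts)
    {x : EuclideanSpace ℝ (Fin n)} (hx : x ∈ c.V) : ContDiffAt ℝ k (f.toFun ∘ c.φ) x :=
  (f.contDiffOn c hc).contDiffAt (c.isOpen_V.mem_nhds hx)

theorem CkFunction.continuousOn_iteratedFDeriv (f : 𝕏.CkFunction k) {c : OrbifoldChart n X}
    (hc : c ∈ 𝕏.charts) {i : ℕ} (hi : i ≤ k) :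
    ContinuousOn (iteratedFDeriv ℝ i (f.toFun ∘ c.φ)) c.V := by
  refine ((f.contDiffOn c hc).continuousOn_iteratedFDerivWithin (by exact_mod_cast hi)
    c.isOpen_V.uniqueDiffOn).congr fun x hx => ?_
  exact (iteratedFDerivWithin_of_isOpen i c.isOpen_V hx).symm

/-- The functions whose representative in the chart `c` has no degenerate critical point in `S`. -/
def nondegenerateSet (𝕏 : Orbifold n X) (k : ℕ) (c : OrbifoldChart n X)
    (S : Set (EuclideanSpace ℝ (Fin n))) : Set (𝕏.CkFunction k) :=
  {f | ∀ x ∈ S, NondegenerateAt (f.toFun ∘ c.φ) x}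

/-- The 2-jet image of K is compact and misses a closed set, hence so does a δ-thickening, which
contains the 2-jets over K of all nearby functions. -/
theorem isOpen_nondegenerateSet (hk : 2 ≤ k) {c : OrbifoldChart n X} (hc : c ∈ 𝕏.charts)
    {K : Set (EuclideanSpace ℝ (Fin n))} (hK : IsCompact K) (hKV : K ⊆ c.V) :
    IsOpen (𝕏.nondegenerateSet k c K) := by
  rw [isOpen_iff_eventually]
  intro f hf
  have hcont := ((f.continuousOn_iteratedFDeriv hc (i := 1) (by omega)).prodMk
    (f.continuousOn_iteratedFDeriv hc (i := 2) hk)).mono hKV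
  obtain ⟨δ, hδ, hsub⟩ := (hK.image_of_continuousOn hcont).exists_thickening_subset_open
    isClosed_degenerateJets.isOpen_compl (by
      rintro _ ⟨x, hx, rfl⟩
      exact nondegenerateAt_iff_notMem_degenerateJets.1 (hf x hx))
  have htend := tendsto_ckFunction_iff.1 (Filter.tendsto_id (x := 𝓝 f)) c hc
  filter_upwards [Metric.tendstoUniformlyOn_iff.1 (htend 1 (by omega) K hK hKV) δ hδ,
    Metric.tendstoUniformlyOn_iff.1 (htend 2 hk K hK hKV) δ hδ] with g h1 h2 x hx
  refine nondegenerateAt_iff_notMem_degenerateJets.2 (hsub ?_)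
  refine Metric.mem_thickening_iff.2 ⟨_, mem_image_of_mem _ hx, ?_⟩
  rw [Prod.dist_eq, dist_comm, dist_comm (iteratedFDeriv ℝ 2 _ x)]
  exact max_lt (h1 x hx) (h2 x hx)

/-- The set of points at which a function is nondegenerate is open. -/
theorem isOpen_nondegenerateAt (hk : 2 ≤ k) {c : OrbifoldChart n X} (hc : c ∈ 𝕏.charts)
    (f : 𝕏.CkFunction k) : IsOpen {x ∈ c.V | NondegenerateAt (f.toFun ∘ c.φ) x} := by
  have hcont := (f.continuousOn_iteratedFDeriv hc (i := 1) (by omega)).prodMk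
    (f.continuousOn_iteratedFDeriv hc (i := 2) hk)
  simp_rw [nondegenerateAt_iff_notMem_degenerateJets]
  exact hcont.isOpen_inter_preimage c.isOpen_V isClosed_degenerateJets.isOpen_compl

/-- The function `f + ∑ tⱼ qⱼ`. -/
def CkFunction.addCombination {ι : Type*} [Fintype ι] (f : 𝕏.CkFunction k)
    (q : ι → 𝕏.CkFunction k) (t : ι → ℝ) : 𝕏.CkFunction k where
  toFun := fun p => f.toFun p + ∑ j, t j * (q j).toFun p
  contDiffOn := fun c hc => (f.contDiffOn c hc).add
    (ContDiffOn.sum fun j _ => contDiffOn_const.mul ((q j).contDiffOn c hc))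

theorem CkFunction.iteratedFDeriv_addCombination {ι : Type*} [Fintype ι] (f : 𝕏.CkFunction k)
    (q : ι → 𝕏.CkFunction k) (t : ι → ℝ) {c : OrbifoldChart n X} (hc : c ∈ 𝕏.charts) {i : ℕ}
    (hi : i ≤ k) {x : EuclideanSpace ℝ (Fin n)} (hx : x ∈ c.V) :
    iteratedFDeriv ℝ i ((f.addCombination q t).toFun ∘ c.φ) x =
      iteratedFDeriv ℝ i (f.toFun ∘ c.φ) x +
        ∑ j, t j • iteratedFDeriv ℝ i ((q j).toFun ∘ c.φ) x := by
  have hik : (i : WithTop ℕ∞) ≤ k := by exact_mod_cast hi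
  have hq : ∀ j, ContDiffAt ℝ i (t j • ((q j).toFun ∘ c.φ)) x := fun j =>
    (((q j).contDiffAt hc hx).of_le hik).const_smul (t j)
  have heq : (f.addCombination q t).toFun ∘ c.φ =
      f.toFun ∘ c.φ + ∑ j, t j • ((q j).toFun ∘ c.φ) := by
    ext y
    simp [addCombination]
  rw [heq, iteratedFDeriv_add_apply ((f.contDiffAt hc hx).of_le hik)
    (by rw [Finset.sum_fn]; exact ContDiffAt.sum fun j _ => hq j),
    iteratedFDeriv_sum_apply fun j _ => hq j]
  congr 1
  exact Finset.sum_congr rfl fun j _ =>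
    iteratedFDeriv_const_smul_apply (((q j).contDiffAt hc hx).of_le hik)

theorem CkFunction.tendsto_addCombination {ι : Type*} [Fintype ι] (f : 𝕏.CkFunction k)
    (q : ι → 𝕏.CkFunction k) : Filter.Tendsto (f.addCombination q) (𝓝 0) (𝓝 f) := by
  refine tendsto_ckFunction_iff.2 fun c hc i hi K hK hKV => ?_
  have hbd : ∀ j, ∃ C, ∀ x ∈ K, ‖iteratedFDeriv ℝ i ((q j).toFun ∘ c.φ) x‖ ≤ C := fun j =>
    hK.exists_bound_of_continuousOn (((q j).continuousOn_iteratedFDeriv hc hi).mono hKV)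
  choose C hC using hbd
  have hlim : Filter.Tendsto (fun t : ι → ℝ => ∑ j, |t j| * C j) (𝓝 0) (𝓝 0) := by
    have : Continuous fun t : ι → ℝ => ∑ j, |t j| * C j := by fun_prop
    simpa using this.tendsto 0
  rw [Metric.tendstoUniformlyOn_iff]
  intro ε hε
  filter_upwards [hlim.eventually (gt_mem_nhds hε)] with t ht x hx
  rw [f.iteratedFDeriv_addCombination q t hc hi (hKV hx), dist_self_add_right]
  refine lt_of_le_of_lt (norm_sum_le _ _) (lt_of_le_of_lt (Finset.sum_le_sum fun j _ => ?_) ht)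
  rw [norm_smul, Real.norm_eq_abs]
  exact mul_le_mul_of_nonneg_left (hC j x hx) (abs_nonneg _)

end Orbifold

/-! ### Local inverses. -/

section InverseFunction

variable {E : Type*} [NormedAddCommGroup E] [NormedSpace ℝ E]

theorem injective_fderiv_of_eventually_leftInverse {T S : E → E} {x : E}
    (hT : DifferentiableAt ℝ T x) (hS : DifferentiableAt ℝ S (T x))
    (h : ∀ᶠ y in 𝓝 x, S (T y) = y) : Function.Injective (fderiv ℝ T x) := by
  have h1 : S ∘ T =ᶠ[𝓝 x] id := h
  have h2 := h1.fderiv_eq (𝕜 := ℝ)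
  rw [fderiv_comp x hS hT, fderiv_id] at h2
  refine Function.LeftInverse.injective (g := fderiv ℝ S (T x)) fun v => ?_
  exact DFunLike.congr_fun h2 v

theorem exists_local_inverse [FiniteDimensional ℝ E] {T : E → E} {x : E} {m : WithTop ℕ∞}
    (hm : m ≠ 0) (hT : ContDiffAt ℝ m T x) (hinj : Function.Injective (fderiv ℝ T x)) :
    ∃ S : E → E, ContDiffAt ℝ m S (T x) ∧ S (T x) = x ∧ (∀ᶠ y in 𝓝 (T x), T (S y) = y) ∧
      (∀ᶠ y in 𝓝 x, S (T y) = y) ∧ Function.Injective (fderiv ℝ S (T x)) := by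
  have : CompleteSpace E := FiniteDimensional.complete ℝ E
  let e : E ≃L[ℝ] E :=
    (LinearEquiv.ofInjectiveEndo (fderiv ℝ T x).toLinearMap hinj).toContinuousLinearEquiv
  have he : HasFDerivAt T (e : E →L[ℝ] E) x := by
    have : (e : E →L[ℝ] E) = fderiv ℝ T x := by
      ext v
      rfl
    rw [this]
    exact (hT.differentiableAt hm).hasFDerivAt
  have hs : HasStrictFDerivAt T (e : E →L[ℝ] E) x := hT.hasStrictFDerivAt' he hm
  have hS : ContDiffAt ℝ m (hs.localInverse T e x) (T x) := hT.to_localInverse he hm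
  refine ⟨hs.localInverse T e x, hS, hs.localInverse_apply_image, hs.eventually_right_inverse,
    hs.eventually_left_inverse, ?_⟩
  refine injective_fderiv_of_eventually_leftInverse (S := T) (hS.differentiableAt hm) ?_
    hs.eventually_right_inverse
  rw [hs.localInverse_apply_image]
  exact hT.differentiableAt hm

end InverseFunction

/-! ### Transition maps between compatible charts. -/

namespace OrbifoldChart

variable {n : ℕ} {X : Type u} [TopologicalSpace X] (c : OrbifoldChart n X)

theorem contDiffAt_act (g : c.Γ) {x : EuclideanSpace ℝ (Fin n)} (hx : x ∈ c.V) :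
    ContDiffAt ℝ ∞ (c.act g) x :=
  (c.act_smooth g).contDiffAt (c.isOpen_V.mem_nhds hx)

theorem differentiableAt_act (g : c.Γ) {x : EuclideanSpace ℝ (Fin n)} (hx : x ∈ c.V) :
    DifferentiableAt ℝ (c.act g) x :=
  (c.contDiffAt_act g hx).differentiableAt (by simp)

theorem eventually_mem_V {x : EuclideanSpace ℝ (Fin n)} (hx : x ∈ c.V) : ∀ᶠ y in 𝓝 x, y ∈ c.V :=
  c.isOpen_V.mem_nhds hx

theorem act_inv_act (g : c.Γ) {x : EuclideanSpace ℝ (Fin n)} (hx : x ∈ c.V) :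
    c.act g⁻¹ (c.act g x) = x := by
  rw [← c.act_mul _ _ x hx, inv_mul_cancel, c.act_one x hx]

theorem injective_fderiv_act (g : c.Γ) {x : EuclideanSpace ℝ (Fin n)} (hx : x ∈ c.V) :
    Function.Injective (fderiv ℝ (c.act g) x) :=
  injective_fderiv_of_eventually_leftInverse (S := c.act g⁻¹) (c.differentiableAt_act g hx)
    (c.differentiableAt_act g⁻¹ (c.act_mapsTo g hx))
    ((c.eventually_mem_V hx).mono fun _ hy => c.act_inv_act g hy)

variable {c}

/-- Points of two compatible charts with the same image are related by a local diffeomorphism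
over `X`. -/
theorem Compatible.exists_transition {c' : OrbifoldChart n X} (h : c'.Compatible c)
    {y' y : EuclideanSpace ℝ (Fin n)} (hy' : y' ∈ c'.V) (hy : y ∈ c.V) (heq : c'.φ y' = c.φ y) :
    ∃ T : EuclideanSpace ℝ (Fin n) → EuclideanSpace ℝ (Fin n), T y' = y ∧
      ContDiffAt ℝ ∞ T y' ∧ Function.Injective (fderiv ℝ T y') ∧
      ∀ᶠ z in 𝓝 y', c.φ (T z) = c'.φ z := by
  obtain ⟨w, ⟨z, hz, hzy⟩, ⟨e'⟩, ⟨e⟩⟩ := h (c'.φ y') ⟨mem_image_of_mem _ hy', y, hy, heq.symm⟩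
  -- The embeddings of w hit y' and y only up to the group actions; T is g ∘ ψ ∘ ψ'⁻¹ ∘ g'.
  obtain ⟨g', hg'⟩ := c'.φ_injective_mod y' hy' (e'.ψ z) (e'.ψ_mapsTo hz)
    (by rw [e'.φ_comp z hz, hzy])
  obtain ⟨g, hg⟩ := c.φ_injective_mod (e.ψ z) (e.ψ_mapsTo hz) y hy
    (by rw [e.φ_comp z hz, hzy, heq])
  have hψ' := e'.ψ_smooth.contDiffAt (w.isOpen_V.mem_nhds hz)
  have hψ := e.ψ_smooth.contDiffAt (w.isOpen_V.mem_nhds hz)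
  obtain ⟨S, hS, hSz, hright, -, hSinj⟩ :=
    exists_local_inverse (by simp) hψ' (e'.ψ_immersion z hz)
  have hact' := c'.contDiffAt_act g' hy'
  have hact := c.contDiffAt_act g (e.ψ_mapsTo hz)
  have hS1 : ContDiffAt ℝ ∞ (S ∘ c'.act g') y' := (show ContDiffAt ℝ ∞ S (c'.act g' y') by
    rwa [hg']).comp y' hact'
  have hS1z : (S ∘ c'.act g') y' = z := by simp [hg', hSz]
  have hS2 : ContDiffAt ℝ ∞ (e.ψ ∘ (S ∘ c'.act g')) y' :=
    (show ContDiffAt ℝ ∞ e.ψ ((S ∘ c'.act g') y') by rwa [hS1z]).comp y' hS1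
  have hS2z : (e.ψ ∘ (S ∘ c'.act g')) y' = e.ψ z := by rw [Function.comp_apply, hS1z]
  have hS3 : ContDiffAt ℝ ∞ (c.act g ∘ (e.ψ ∘ (S ∘ c'.act g'))) y' :=
    (show ContDiffAt ℝ ∞ (c.act g) ((e.ψ ∘ (S ∘ c'.act g')) y') by rwa [hS2z]).comp y' hS2
  refine ⟨c.act g ∘ (e.ψ ∘ (S ∘ c'.act g')), by rw [Function.comp_apply, hS2z, hg], hS3, ?_, ?_⟩
  · have hne : (∞ : WithTop ℕ∞) ≠ 0 := by simp
    rw [fderiv_comp y' (by rw [hS2z]; exact hact.differentiableAt hne)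
        (hS2.differentiableAt hne),
      fderiv_comp y' (by rw [hS1z]; exact hψ.differentiableAt hne) (hS1.differentiableAt hne),
      fderiv_comp y' (by rw [hg']; exact hS.differentiableAt hne) (hact'.differentiableAt hne),
      hS2z, hS1z, hg']
    exact (c.injective_fderiv_act g (e.ψ_mapsTo hz)).comp
      ((e.ψ_immersion z hz).comp (hSinj.comp (c'.injective_fderiv_act g' hy')))
  · have h1 : ∀ᶠ x in 𝓝 y', S (c'.act g' x) ∈ w.V :=
      hS1.continuousAt.eventually (by rw [hS1z]; exact w.eventually_mem_V hz)
    have h2 : ∀ᶠ x in 𝓝 y', e'.ψ (S (c'.act g' x)) = c'.act g' x :=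
      hact'.continuousAt.eventually (by rwa [hg'])
    filter_upwards [h1, h2, c'.eventually_mem_V hy'] with x hx1 hx2 hx3
    simp only [Function.comp_apply]
    rw [c.φ_invariant g _ (e.ψ_mapsTo hx1), e.φ_comp _ hx1, ← e'.φ_comp _ hx1, hx2,
      c'.φ_invariant g' _ hx3]

end OrbifoldChart

/-! ### Descent of functions to X and independence of the chart. -/

namespace Orbifold

variable {n : ℕ} {X : Type u} [TopologicalSpace X] {𝕏 : Orbifold n X} {k : ℕ}

/-- A smooth invariant function with compact support in a chart descends to the orbifold. -/
theorem exists_ckFunction_comp_eq [T2Space X] {c : OrbifoldChart n X} (hc : c ∈ 𝕏.atlas)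
    {u : EuclideanSpace ℝ (Fin n) → ℝ} (hu : ContDiffOn ℝ ∞ u c.V)
    (hinv : ∀ g, ∀ x ∈ c.V, u (c.act g x) = u x) {K : Set (EuclideanSpace ℝ (Fin n))}
    (hK : IsCompact K) (hKV : K ⊆ c.V) (huK : ∀ x ∈ c.V, x ∉ K → u x = 0) :
    ∃ q : 𝕏.CkFunction k, ∀ x ∈ c.V, q.toFun (c.φ x) = u x := by
  classical
  let q : X → ℝ := fun p => if h : ∃ x ∈ c.V, c.φ x = p then u h.choose else 0
  have hq : ∀ x ∈ c.V, q (c.φ x) = u x := by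
    intro x hx
    have hex : ∃ y ∈ c.V, c.φ y = c.φ x := ⟨x, hx, rfl⟩
    obtain ⟨g, hg⟩ := c.φ_injective_mod x hx _ hex.choose_spec.1 hex.choose_spec.2.symm
    simp only [q, dif_pos hex]
    rw [← hg, hinv g x hx]
  have hq0 : ∀ p, p ∉ c.φ '' K → q p = 0 := by
    intro p hp
    by_cases hex : ∃ y ∈ c.V, c.φ y = p
    · obtain ⟨y, hy, rfl⟩ := hex
      rw [hq y hy]
      exact huK y hy fun hyK => hp (mem_image_of_mem _ hyK)
    · simp only [q, dif_neg hex]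
  refine ⟨⟨q, fun c' hc' x hx => ContDiffAt.contDiffWithinAt ?_⟩, hq⟩
  by_cases himg : c'.φ x ∈ c.φ '' c.V
  · obtain ⟨y, hy, hyx⟩ := himg
    obtain ⟨T, hTx, hT, -, hTφ⟩ := (hc' c hc).exists_transition hx hy hyx.symm
    have hu' : ContDiffAt ℝ ∞ u (T x) := by
      rw [hTx]
      exact hu.contDiffAt (c.isOpen_V.mem_nhds hy)
    refine ((hu'.comp x hT).of_le (by exact_mod_cast le_top)).congr_of_eventuallyEq ?_
    filter_upwards [hTφ, hT.continuousAt.eventually (by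
      rw [hTx]; exact c.eventually_mem_V hy)] with z hz1 hz2
    simp only [Function.comp_apply]
    rw [← hz1, hq _ hz2]
  -- Off the image of the chart, extension by zero is smooth because the compact image of K is
  -- closed in the Hausdorff space X.
  · have hclosed : IsClosed (c.φ '' K) :=
      (hK.image_of_continuousOn (c.φ_continuous.mono hKV)).isClosed
    have hcont : ContinuousAt c'.φ x := c'.φ_continuous.continuousAt (c'.isOpen_V.mem_nhds hx)
    have hev : ∀ᶠ z in 𝓝 x, c'.φ z ∉ c.φ '' K :=
      hcont.eventually (hclosed.isOpen_compl.mem_nhds fun h => himg (image_mono hKV h))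
    exact contDiffAt_const (c := (0 : ℝ)).congr_of_eventuallyEq (hev.mono fun z hz => hq0 _ hz)

theorem nondegenerateAt_of_nondegenerateAt_atlas (hk : 2 ≤ k) (f : 𝕏.CkFunction k)
    {c c' : OrbifoldChart n X} (hc : c ∈ 𝕏.atlas) (hc' : c' ∈ 𝕏.charts)
    {y' y : EuclideanSpace ℝ (Fin n)} (hy' : y' ∈ c'.V) (hy : y ∈ c.V) (heq : c'.φ y' = c.φ y)
    (h : NondegenerateAt (f.toFun ∘ c.φ) y) : NondegenerateAt (f.toFun ∘ c'.φ) y' := by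
  obtain ⟨T, rfl, hT, hinj, hTφ⟩ := (hc' c hc).exists_transition hy' hy heq
  have hf : ContDiffAt ℝ 2 (f.toFun ∘ c.φ) (T y') :=
    (f.contDiffAt (atlas_subset_charts hc) hy).of_le (by exact_mod_cast hk)
  refine (h.comp hf (hT.of_le (WithTop.coe_le_coe.2 (le_top : (2 : ℕ∞) ≤ ⊤))) hinj).congr ?_
  filter_upwards [hTφ] with z hz
  simp only [Function.comp_apply, hz]

end Orbifold

/-! ### Linearization of the isotropy action. -/

namespace OrbifoldChart

variable {n : ℕ} {X : Type u} [TopologicalSpace X] (c : OrbifoldChart n X)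
  {x : EuclideanSpace ℝ (Fin n)} (hx : x ∈ c.V)

/-- The isotropy group of a point of the chart. -/
def isotropy : Subgroup c.Γ where
  carrier := {g | c.act g x = x}
  mul_mem' := fun {a b} ha hb => by
    have ha' : c.act a x = x := ha
    have hb' : c.act b x = x := hb
    change c.act (a * b) x = x
    rw [c.act_mul a b x hx, hb', ha']
  one_mem' := c.act_one x hx
  inv_mem' := fun {a} ha => by
    have ha' : c.act a x = x := ha
    change c.act a⁻¹ x = x
    conv_lhs => rw [← ha']
    exact c.act_inv_act a hx

theorem act_isotropy (h : c.isotropy hx) : c.act h x = x := h.2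

/-- The linear action of the isotropy group on the tangent space. -/
noncomputable def isotropyRep :
    c.isotropy hx →* (EuclideanSpace ℝ (Fin n) →L[ℝ] EuclideanSpace ℝ (Fin n)) where
  toFun := fun h => fderiv ℝ (c.act h) x
  map_one' := by
    have : c.act 1 =ᶠ[𝓝 x] id := (c.eventually_mem_V hx).mono fun y hy => c.act_one y hy
    exact this.fderiv_eq.trans fderiv_id
  map_mul' := fun a b => by
    have h1 : c.act (a * b : c.Γ) =ᶠ[𝓝 x] c.act a ∘ c.act b :=
      (c.eventually_mem_V hx).mono fun y hy => c.act_mul a b y hy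
    have h2 := fderiv_comp x (f := c.act b) (g := c.act a)
      (by rw [c.act_isotropy hx b]; exact c.differentiableAt_act a hx) (c.differentiableAt_act b hx)
    rw [c.act_isotropy hx b] at h2
    exact h1.fderiv_eq.trans h2

theorem isotropyRep_apply (h : c.isotropy hx) :
    c.isotropyRep hx h = fderiv ℝ (c.act h) x := rfl

variable [Fintype (c.isotropy hx)]

/-- The average of the maps `y ↦ A h⁻¹ (h y - x)`: an equivariant map from the chart to the tangent
space at `x`. -/
noncomputable def linearization (y : EuclideanSpace ℝ (Fin n)) : EuclideanSpace ℝ (Fin n) :=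
  (Fintype.card (c.isotropy hx) : ℝ)⁻¹ • ∑ h, c.isotropyRep hx h⁻¹ (c.act h y - x)

theorem linearization_self : c.linearization hx x = 0 := by
  simp [linearization, c.act_isotropy hx]

theorem linearization_act (g : c.isotropy hx) {y : EuclideanSpace ℝ (Fin n)} (hy : y ∈ c.V) :
    c.linearization hx (c.act g y) = c.isotropyRep hx g (c.linearization hx y) := by
  unfold linearization
  rw [map_smul, map_sum]
  congr 1
  refine Fintype.sum_equiv (Equiv.mulRight g) _ _ fun h => ?_
  rw [← c.act_mul _ _ y hy, ← mul_apply_eq_comp, ← map_mul]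
  simp

theorem contDiffOn_linearization : ContDiffOn ℝ ∞ (c.linearization hx) c.V := by
  unfold linearization
  refine ContDiffOn.const_smul _ (ContDiffOn.sum fun h _ => ?_)
  exact (c.isotropyRep hx h⁻¹).contDiff.comp_contDiffOn ((c.act_smooth h).sub contDiffOn_const)

/-- Each summand has derivative A(h⁻¹)A(h) = 1. Hence the equivariant average is a local
diffeomorphism at x. -/
theorem fderiv_linearization :
    fderiv ℝ (c.linearization hx) x = ContinuousLinearMap.id ℝ _ := by
  have h1 : ∀ h : c.isotropy hx, HasFDerivAt
      (fun y => c.isotropyRep hx h⁻¹ (c.act h y - x))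
      (ContinuousLinearMap.id ℝ (EuclideanSpace ℝ (Fin n))) x := fun h => by
    have h2 := (c.isotropyRep hx h⁻¹).hasFDerivAt.comp x
      ((c.differentiableAt_act h hx).hasFDerivAt.sub_const x)
    have h3 : (c.isotropyRep hx h⁻¹).comp (fderiv ℝ (c.act h) x) =
        ContinuousLinearMap.id ℝ _ := by
      rw [← c.isotropyRep_apply hx h]
      change c.isotropyRep hx h⁻¹ * c.isotropyRep hx h = 1
      rw [← map_mul, inv_mul_cancel, map_one]
    rwa [h3] at h2
  have h4 := (HasFDerivAt.fun_sum fun h (_ : h ∈ Finset.univ) => h1 h).const_smul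
    (Fintype.card (c.isotropy hx) : ℝ)⁻¹
  refine h4.fderiv.trans ?_
  rw [Finset.sum_const, Finset.card_univ, ← Nat.cast_smul_eq_nsmul ℝ,
    inv_smul_smul₀ (by exact_mod_cast Fintype.card_ne_zero)]

end OrbifoldChart

/-! ### Slices and density along fixed points. -/

namespace Orbifold

variable {n : ℕ} {X : Type u} [TopologicalSpace X] {𝕏 : Orbifold n X}

/-- Near `x`, the average of a smooth function over the isotropy group of `x` is the
representative of a function on the orbifold. -/
theorem exists_ckFunction_eq_sum_isotropy [T2Space X] (k : ℕ) {c : OrbifoldChart n X}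
    (hc : c ∈ 𝕏.atlas) {x : EuclideanSpace ℝ (Fin n)} (hx : x ∈ c.V) [Fintype (c.isotropy hx)] :
    ∀ᶠ s in (𝓝 x).smallSets, ∀ v, ContDiffOn ℝ ∞ v c.V →
      ∃ q : 𝕏.CkFunction k, ∀ y ∈ s, q.toFun (c.φ y) = ∑ h : c.isotropy hx, v (c.act h y) := by
  classical
  have : Fintype c.Γ := Fintype.ofFinite _
  have hO : c.V ∩ ⋂ g ∈ {g : c.Γ | c.act g x ≠ x}, {c.act g x}ᶜ ∈ 𝓝 x := by
    refine Filter.inter_mem (c.isOpen_V.mem_nhds hx)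
      ((Filter.biInter_mem (toFinite _)).2 fun g hg => ?_)
    exact isOpen_compl_singleton.mem_nhds (Ne.symm hg)
  obtain ⟨R, hR, hRO⟩ := Metric.nhds_basis_closedBall.mem_iff.1 hO
  have hRV : Metric.closedBall x R ⊆ c.V := hRO.trans inter_subset_left
  let χ : ContDiffBump x := ⟨R / 2, R, by positivity, by linarith⟩
  have hχ0 : ∀ y, y ∉ Metric.closedBall x R → χ y = 0 := fun y hy =>
    χ.zero_of_le_dist (not_le.1 hy).le
  have h1 : ∀ᶠ y in 𝓝 x, ∀ h : c.isotropy hx, χ (c.act h y) = 1 := by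
    refine Filter.eventually_all.2 fun h => ?_
    refine (c.contDiffAt_act h hx).continuousAt.eventually (p := fun z => χ z = 1) ?_
    rw [c.act_isotropy hx h]
    exact χ.eventuallyEq_one
  have h2 : ∀ᶠ y in 𝓝 x, ∀ g : c.Γ, g ∉ c.isotropy hx → χ (c.act g y) = 0 := by
    refine Filter.eventually_all.2 fun g => ?_
    by_cases hg : g ∈ c.isotropy hx
    · exact Filter.Eventually.of_forall fun y hy => absurd hg hy
    have hgx : c.act g x ∉ Metric.closedBall x R := fun hmem => by
      have := (hRO hmem).2
      simp only [mem_iInter] at this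
      exact this g hg rfl
    filter_upwards [(c.contDiffAt_act g hx).continuousAt.eventually
      (Metric.isClosed_closedBall.isOpen_compl.mem_nhds hgx)] with y hy _
    exact hχ0 _ hy
  rw [Filter.eventually_smallSets]
  refine ⟨_, (h1.and h2).and (c.eventually_mem_V hx), fun s hs v hv => ?_⟩
  -- Sum χ·v over the whole group to get invariance. Near x, elements outside the isotropy group
  -- move y off the support of χ, while χ = 1 at the images under the others.
  obtain ⟨q, hq⟩ := exists_ckFunction_comp_eq (k := k) hc
    (u := fun y => ∑ g : c.Γ, χ (c.act g y) * v (c.act g y))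
    (K := ⋃ g : c.Γ, c.act g '' Metric.closedBall x R)
    (ContDiffOn.sum fun g _ => (χ.contDiff.comp_contDiffOn (c.act_smooth g)).mul
      (hv.comp (c.act_smooth g) (c.act_mapsTo g)))
    (fun g y hy => Fintype.sum_equiv (Equiv.mulRight g) _ _ fun g' => by
      simp [c.act_mul g' g y hy])
    (isCompact_iUnion fun g => (isCompact_closedBall x R).image_of_continuousOn
      ((c.act_smooth g).continuousOn.mono hRV))
    (iUnion_subset fun g => (image_mono hRV).trans (c.act_mapsTo g).image_subset)
    (fun y hy hyK => Finset.sum_eq_zero fun g _ => by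
      rw [hχ0, zero_mul]
      refine fun hmem => hyK (mem_iUnion.2 ⟨g⁻¹, _, hmem, c.act_inv_act g hy⟩))
  refine ⟨q, fun y hy => ?_⟩
  obtain ⟨⟨hy1, hy2⟩, hyV⟩ := hs hy
  rw [hq y hyV, ← Finset.sum_filter_of_ne (p := fun g => g ∈ c.isotropy hx)
    (fun g _ hg => by_contra fun hg' => hg (by rw [hy2 g hg', zero_mul])),
    Finset.sum_subtype (F := ‹Fintype (c.isotropy hx)›) _ (by simp)]
  refine Finset.sum_congr (by ext; simp) fun h _ => ?_
  rw [hy1 h, one_mul]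

end Orbifold

namespace Orbifold

variable {n : ℕ} {X : Type u} [TopologicalSpace X] {𝕏 : Orbifold n X}

/-- Linear coordinates around a point of a chart: the isotropy group acts linearly, and averages
of smooth functions are representatives of functions on the orbifold. -/
theorem exists_slice [T2Space X] (k : ℕ) {c : OrbifoldChart n X} (hc : c ∈ 𝕏.atlas)
    {x : EuclideanSpace ℝ (Fin n)} (hx : x ∈ c.V) [Fintype (c.isotropy hx)] :
    ∃ (Ψ : EuclideanSpace ℝ (Fin n) → EuclideanSpace ℝ (Fin n)) (r : ℝ), 0 < r ∧
      (∀ ρ > 0, Ψ '' Metric.ball 0 ρ ∈ 𝓝 x) ∧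
      (∀ z ∈ Metric.ball 0 r, Ψ z ∈ c.V ∧ ContDiffAt ℝ 2 Ψ z ∧
        Function.Injective (fderiv ℝ Ψ z) ∧ c.linearization hx (Ψ z) = z ∧
        ∀ h, Ψ (c.isotropyRep hx h z) = c.act h (Ψ z)) ∧
      ∀ ℓ : EuclideanSpace ℝ (Fin n) → ℝ, ContDiff ℝ ∞ ℓ → ∃ q : 𝕏.CkFunction k,
        ∀ z ∈ Metric.ball 0 r, q.toFun (c.φ (Ψ z)) = ∑ h, ℓ (c.isotropyRep hx h z) := by
  set Φ := c.linearization hx with hΦdef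
  have hΦ : ∀ y ∈ c.V, ContDiffAt ℝ ∞ Φ y := fun y hy =>
    (c.contDiffOn_linearization hx).contDiffAt (c.isOpen_V.mem_nhds hy)
  have hΦinj : Function.Injective (fderiv ℝ Φ x) := by
    rw [hΦdef, c.fderiv_linearization hx]
    exact Function.injective_id
  obtain ⟨Ψ, hΨ, hΨ0, hright, hleft, -⟩ := exists_local_inverse (by simp) (hΦ x hx) hΦinj
  have hΦx : Φ x = 0 := c.linearization_self hx
  rw [hΦx] at hΨ hΨ0 hright
  obtain ⟨s, hs, hsq⟩ := Filter.eventually_smallSets.1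
    (exists_ckFunction_eq_sum_isotropy (𝕏 := 𝕏) k hc hx)
  have hcont : Filter.Tendsto Ψ (𝓝 0) (𝓝 x) := by
    have := hΨ.continuousAt.tendsto
    rwa [hΨ0] at this
  have hV : ∀ᶠ z in 𝓝 0, Ψ z ∈ c.V := hcont.eventually (c.eventually_mem_V hx)
  have hC2 : ∀ᶠ z in 𝓝 0, ContDiffAt ℝ 2 Ψ z :=
    (hΨ.of_le (WithTop.coe_le_coe.2 (le_top : (2 : ℕ∞) ≤ ⊤))).eventually (by decide)
  have hequiv : ∀ᶠ z in 𝓝 0, ∀ h : c.isotropy hx, Φ (c.act h (Ψ z)) = c.isotropyRep hx h z ∧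
      Ψ (c.isotropyRep hx h z) = c.act h (Ψ z) := by
    refine Filter.eventually_all.2 fun h => ?_
    have hact : Filter.Tendsto (fun z => c.act h (Ψ z)) (𝓝 0) (𝓝 x) := by
      have := (c.contDiffAt_act h hx).continuousAt.tendsto
      rw [c.act_isotropy hx h] at this
      exact this.comp hcont
    filter_upwards [hV, hright, hact.eventually hleft] with z h1 h2 h3
    have h4 : Φ (c.act h (Ψ z)) = c.isotropyRep hx h z := by
      rw [hΦdef, c.linearization_act hx h h1, ← hΦdef, h2]
    exact ⟨h4, by rw [← h4, h3]⟩
  obtain ⟨r, hr, hball⟩ := Metric.eventually_nhds_iff_ball.1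
    ((((hV.and hC2).and (hright.eventually_nhds)).and hequiv).and (hcont.eventually hs))
  refine ⟨Ψ, r, hr, fun ρ hρ => ?_, fun z hz => ?_, fun ℓ hℓ => ?_⟩
  · have h1 : Filter.Tendsto Φ (𝓝 x) (𝓝 0) := by
      have := (hΦ x hx).continuousAt.tendsto
      rwa [hΦx] at this
    filter_upwards [hleft, h1.eventually (Metric.ball_mem_nhds 0 hρ)] with y hy1 hy2
    exact ⟨Φ y, hy2, hy1⟩
  · obtain ⟨⟨⟨⟨h1, h2⟩, h3⟩, h4⟩, -⟩ := hball z hz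
    refine ⟨h1, h2, ?_, h3.self_of_nhds, fun h => (h4 h).2⟩
    exact injective_fderiv_of_eventually_leftInverse (h2.differentiableAt (by simp))
      ((hΦ _ h1).differentiableAt (by simp)) h3
  · obtain ⟨q, hq⟩ := hsq s subset_rfl (ℓ ∘ Φ)
      (hℓ.comp_contDiffOn (c.contDiffOn_linearization hx))
    refine ⟨q, fun z hz => ?_⟩
    obtain ⟨⟨-, h4⟩, h5⟩ := hball z hz
    rw [hq _ h5]
    exact Finset.sum_congr rfl fun h _ => congrArg ℓ (h4 h).1

/-- Around every point of a chart, a generic function is nondegenerate at the nearby points that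
are fixed by the isotropy group. -/
theorem exists_dense_nondegenerateSet_fixed [T2Space X] {k : ℕ} (hk : 2 ≤ k)
    {c : OrbifoldChart n X} (hc : c ∈ 𝕏.atlas) {x : EuclideanSpace ℝ (Fin n)} (hx : x ∈ c.V) :
    ∃ W ∈ 𝓝 x, IsCompact W ∧ W ⊆ c.V ∧
      Dense (𝕏.nondegenerateSet k c {y ∈ W | ∀ g, c.act g x = x → c.act g y = y}) := by
  have : Fintype (c.isotropy hx) := Fintype.ofFinite _
  obtain ⟨Ψ, r, hr, hnhds, hΨ, hq⟩ := exists_slice (𝕏 := 𝕏) k hc hx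
  set A := c.isotropyRep hx with hA
  have hsub : Metric.closedBall (0 : EuclideanSpace ℝ (Fin n)) (r / 2) ⊆ Metric.ball 0 r :=
    Metric.closedBall_subset_ball (by linarith)
  have hΨc : ContinuousOn Ψ (Metric.closedBall 0 (r / 2)) := fun z hz =>
    (hΨ z (hsub hz)).2.1.continuousAt.continuousWithinAt
  have hC2 : ∀ f : 𝕏.CkFunction k, ∀ z ∈ Metric.ball 0 r,
      ContDiffAt ℝ 2 (f.toFun ∘ c.φ) (Ψ z) := fun f z hz =>
    (f.contDiffAt (atlas_subset_charts hc) (hΨ z hz).1).of_le (by exact_mod_cast hk)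
  have hC2Ψ : ∀ f : 𝕏.CkFunction k, ∀ z ∈ Metric.ball 0 r,
      ContDiffAt ℝ 2 ((f.toFun ∘ c.φ) ∘ Ψ) z := fun f z hz => (hC2 f z hz).comp z (hΨ z hz).2.1
  refine ⟨Ψ '' Metric.closedBall 0 (r / 2), Filter.mem_of_superset (hnhds (r / 2) (by positivity))
    (image_mono Metric.ball_subset_closedBall), (isCompact_closedBall _ _).image_of_continuousOn hΨc,
    ?_, dense_iff_inter_open.2 ?_⟩
  · rintro _ ⟨z, hz, rfl⟩
    exact (hΨ z (hsub hz)).1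
  rintro O hO ⟨f, hf⟩
  -- The averaged coordinate functions span all averaged linear functionals; q₀ below represents
  -- `normalSq`.
  choose q hqeq using fun j : Fin n => hq (fun y => y j) (by fun_prop)
  obtain ⟨q₀, hq₀⟩ := hq (fun y => 2⁻¹ * ‖y - LinearRep.avg A y‖ ^ 2) (by
    refine contDiff_const.mul (ContDiff.norm_sq ℝ ?_)
    fun_prop)
  have hf1 : ∀ᶠ a : EuclideanSpace ℝ (Fin n) in 𝓝 0, f.addCombination q (fun j => a j) ∈ O := by
    have hcoe : Continuous fun a : EuclideanSpace ℝ (Fin n) => fun j => a j := by fun_prop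
    exact ((f.tendsto_addCombination q).comp (hcoe.tendsto' 0 0 rfl)).eventually (hO.mem_nhds hf)
  obtain ⟨ε, hε, hεO⟩ := Metric.eventually_nhds_iff_ball.1 hf1
  obtain ⟨a, ha, hnd⟩ := LinearRep.exists_linear_perturbation A (hC2Ψ f) hε
  set f₁ := f.addCombination q (fun j => a j) with hf₁
  have hf₁O : f₁ ∈ O := hεO a (by simpa using ha)
  have hf₁eq : ∀ z ∈ Metric.ball 0 r, f₁.toFun (c.φ (Ψ z)) =
      f.toFun (c.φ (Ψ z)) + ∑ h, inner ℝ a (A h z) := fun z hz => by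
    simp only [hf₁, CkFunction.addCombination, hqeq _ z hz, Finset.mul_sum]
    rw [Finset.sum_comm]
    simp [PiLp.inner_apply, mul_comm]
  have hball : ∀ z ∈ Metric.ball (0 : EuclideanSpace ℝ (Fin n)) r,
      ∀ᶠ y in 𝓝 z, y ∈ Metric.ball 0 r := fun z hz => Metric.isOpen_ball.mem_nhds hz
  have hfin := LinearRep.finite_not_nondegenerateAt_add_normalSq A
    (G := (f₁.toFun ∘ c.φ) ∘ Ψ) (isCompact_closedBall 0 (r / 2))
    (fun z hz => hC2Ψ f₁ z (hsub hz))
    (fun z hz h => by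
      filter_upwards [hball z (hsub hz)] with y hy
      simp only [Function.comp_apply, (hΨ y hy).2.2.2.2 h, c.φ_invariant _ _ (hΨ y hy).1])
    (fun z hz => (hnd z (hsub hz)).congr (by
      filter_upwards [continuous_subtype_val.continuousAt.eventually (hball z (hsub hz))] with y hy
      exact hf₁eq y hy))
  have hf2 : ∀ᶠ s : ℝ in 𝓝 0, f₁.addCombination (fun _ : Unit => q₀) (fun _ => s) ∈ O := by
    have hcoe : Continuous fun s : ℝ => fun _ : Unit => s := by fun_prop
    exact ((f₁.tendsto_addCombination _).comp (hcoe.tendsto' 0 0 rfl)).eventually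
      (hO.mem_nhds hf₁O)
  obtain ⟨s, hsO, hs⟩ := mem_closure_iff_nhds.1
    ((hfin.countable.dense_compl ℝ).closure_eq ▸ mem_univ (0 : ℝ)) _ hf2
  refine ⟨_, hsO, ?_⟩
  rintro _ ⟨⟨z, hz, rfl⟩, hfix⟩
  -- Equivariance of the linearization turns fixed points of the chart action into fixed vectors.
  have hzfix : z ∈ LinearRep.fixed A := fun h => by
    have h1 := c.linearization_act hx h (hΨ z (hsub hz)).1
    rw [hfix h h.2, (hΨ z (hsub hz)).2.2.2.1] at h1
    exact h1.symm
  refine NondegenerateAt.of_comp (hC2 _ z (hsub hz)) (hΨ z (hsub hz)).2.1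
    (hΨ z (hsub hz)).2.2.1 ((not_not.1 hs z hz hzfix).congr ?_)
  filter_upwards [hball z (hsub hz)] with y hy
  simp [CkFunction.addCombination, hq₀ y hy, LinearRep.normalSq]

end Orbifold

/-! ### Strata of isotropy order and the global argument. -/

theorem dense_biInter_finset_of_isOpen {Y ι : Type*} [TopologicalSpace Y] (s : Finset ι)
    {U : ι → Set Y} (ho : ∀ i ∈ s, IsOpen (U i)) (hd : ∀ i ∈ s, Dense (U i)) :
    Dense (⋂ i ∈ s, U i) := by
  classical
  induction s using Finset.induction_on with
  | empty => simp
  | insert i s hi ih =>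
    rw [Finset.set_biInter_insert]
    exact (hd i (by simp)).inter_of_isOpen_left
      (ih (fun j hj => ho j (by simp [hj])) fun j hj => hd j (by simp [hj])) (ho i (by simp))

namespace OrbifoldChart

variable {n : ℕ} {X : Type u} [TopologicalSpace X] (c : OrbifoldChart n X)

/-- The order of the isotropy group of a point of the chart. -/
noncomputable def isotropyOrder (x : EuclideanSpace ℝ (Fin n)) : ℕ := {g | c.act g x = x}.ncard

/-- A group element that moves x also moves all nearby points, so isotropy can only shrink. -/
theorem eventually_isotropy_subset {x : EuclideanSpace ℝ (Fin n)} (hx : x ∈ c.V) :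
    ∀ᶠ y in 𝓝 x, {g | c.act g y = y} ⊆ {g | c.act g x = x} := by
  have : ∀ᶠ y in 𝓝 x, ∀ g, c.act g y = y → c.act g x = x := by
    refine Filter.eventually_all.2 fun g => ?_
    by_cases hg : c.act g x = x
    · exact Filter.Eventually.of_forall fun _ _ => hg
    · have hne := ((c.contDiffAt_act g hx).continuousAt.prodMk continuousAt_id).eventually
        (isClosed_diagonal.isOpen_compl.mem_nhds hg)
      exact hne.mono fun y hy h => absurd h hy
  exact this

theorem isOpen_isotropyOrder_lt (m : ℕ) : IsOpen {x ∈ c.V | c.isotropyOrder x < m} := by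
  rw [isOpen_iff_mem_nhds]
  rintro x ⟨hx, hlt⟩
  filter_upwards [c.eventually_mem_V hx, c.eventually_isotropy_subset hx] with y hy hsub
  exact ⟨hy, (ncard_le_ncard hsub (toFinite _)).trans_lt hlt⟩

theorem isCompact_le_isotropyOrder {K : Set (EuclideanSpace ℝ (Fin n))} (hK : IsCompact K)
    (hKV : K ⊆ c.V) (m : ℕ) : IsCompact {x ∈ K | m ≤ c.isotropyOrder x} := by
  convert hK.diff (c.isOpen_isotropyOrder_lt m) using 1
  ext x
  simp only [mem_ofPred_eq, mem_sdiff, not_and, not_lt]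
  exact and_congr_right fun hx => ⟨fun h _ => h, fun h => h (hKV hx)⟩

theorem isCompact_fixed {W : Set (EuclideanSpace ℝ (Fin n))} (hW : IsCompact W) (hWV : W ⊆ c.V)
    (x : EuclideanSpace ℝ (Fin n)) :
    IsCompact {y ∈ W | ∀ g, c.act g x = x → c.act g y = y} := by
  have hopen : ∀ g, IsOpen {y ∈ c.V | c.act g y ≠ y} := fun g =>
    ((c.act_smooth g).continuousOn.prodMk continuousOn_id).isOpen_inter_preimage c.isOpen_V
      isClosed_diagonal.isOpen_compl
  convert hW.diff (isOpen_biUnion fun g (_ : g ∈ {g | c.act g x = x}) => hopen g) using 1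
  ext y
  simp only [mem_ofPred_eq, mem_sdiff, mem_iUnion, not_exists, not_and, not_not]
  exact and_congr_right fun hy => ⟨fun h g hg _ => h g hg, fun h g hg => h g hg (hWV hy)⟩

end OrbifoldChart

namespace Orbifold

variable {n : ℕ} {X : Type u} [TopologicalSpace X] {𝕏 : Orbifold n X} {k : ℕ}

/-- Once f is nondegenerate at orders above m, its bad points in K of order at least m form a
compact set of points of order exactly m. Finitely many local perturbations treat it, kept small
enough to preserve nondegeneracy on the compact remainder D. -/
theorem dense_nondegenerateSet_le_isotropyOrder [T2Space X] (hk : 2 ≤ k) {c : OrbifoldChart n X}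
    (hc : c ∈ 𝕏.atlas) {K : Set (EuclideanSpace ℝ (Fin n))} (hK : IsCompact K) (hKV : K ⊆ c.V)
    (d m : ℕ) (hm : Nat.card c.Γ < m + d) :
    Dense (𝕏.nondegenerateSet k c {x ∈ K | m ≤ c.isotropyOrder x}) := by
  have hcc := atlas_subset_charts hc
  induction d generalizing m with
  | zero =>
    have hempty : {x ∈ K | m ≤ c.isotropyOrder x} = ∅ := by
      refine eq_empty_of_forall_notMem fun x hx => ?_
      have h1 : c.isotropyOrder x ≤ Nat.card c.Γ := ncard_le_card _
      have h2 := hx.2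
      omega
    rw [hempty]
    simp [nondegenerateSet]
  | succ d ih =>
    refine dense_iff_inter_open.2 fun O hO hne => ?_
    obtain ⟨f, hfO, hf⟩ := (ih (m + 1) (by omega)).inter_open_nonempty O hO hne
    have hL := c.isCompact_le_isotropyOrder hK hKV m
    have hN := isOpen_nondegenerateAt hk hcc f
    set L := {x ∈ K | m ≤ c.isotropyOrder x} with hLdef
    set N := {x ∈ c.V | NondegenerateAt (f.toFun ∘ c.φ) x} with hNdef
    have hexact : ∀ x ∈ L \ N, c.isotropyOrder x = m := by
      rintro x ⟨⟨hxK, hxm⟩, hxN⟩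
      by_contra hne
      exact hxN ⟨hKV hxK, hf x ⟨hxK, by omega⟩⟩
    have hLV : ∀ x : (L \ N : Set _), (x : EuclideanSpace ℝ (Fin n)) ∈ c.V := fun x => hKV x.2.1.1
    choose W hWx hWc hWV hWd using fun x : (L \ N : Set _) =>
      exists_dense_nondegenerateSet_fixed (𝕏 := 𝕏) hk hc (hLV x)
    have hU : ∀ x (hx : x ∈ L \ N), interior (W ⟨x, hx⟩ ∩
        {y | {g | c.act g y = y} ⊆ {g | c.act g x = x}}) ∈ 𝓝 x := fun x hx =>
      interior_mem_nhds.2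
        (Filter.inter_mem (hWx ⟨x, hx⟩) (c.eventually_isotropy_subset (hLV ⟨x, hx⟩)))
    obtain ⟨s, hs⟩ := (hL.diff hN).elim_nhds_subcover' _ hU
    set D := L \ ⋃ x ∈ s, interior (W x ∩ {y | {g | c.act g y = y} ⊆ {g | c.act g x = x}})
      with hDdef
    have hD : IsCompact D := hL.diff (isOpen_biUnion fun x _ => isOpen_interior)
    have hfD : f ∈ 𝕏.nondegenerateSet k c D := fun x hx =>
      (by_contra fun hxN => hx.2 (hs ⟨hx.1, hxN⟩) : x ∈ N).2
    have hOD : IsOpen (𝕏.nondegenerateSet k c D) :=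
      isOpen_nondegenerateSet hk hcc hD fun x hx => hKV hx.1.1
    obtain ⟨f', ⟨hf'O, hf'D⟩, hf'⟩ := (dense_biInter_finset_of_isOpen s
      (fun x _ => isOpen_nondegenerateSet hk hcc (c.isCompact_fixed (hWc x) (hWV x) x)
        fun y hy => hWV x hy.1) fun x _ => hWd x).inter_open_nonempty
      _ (hO.inter hOD) ⟨f, hfO, hfD⟩
    refine ⟨f', hf'O, fun y hy => ?_⟩
    by_cases hyD : y ∈ D
    · exact hf'D y hyD
    · have hys : y ∈ ⋃ x ∈ s, interior
          (W x ∩ {y | {g | c.act g y = y} ⊆ {g | c.act g x = x}}) :=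
        by_contra fun h => hyD ⟨hy, h⟩
      simp only [mem_iUnion] at hys
      obtain ⟨x, hxs, hyx⟩ := hys
      obtain ⟨hyW, hsub⟩ := interior_subset hyx
      -- The isotropy of y lies in that of x and has at least m elements, so the two agree and y is
      -- fixed by the isotropy group of x.
      have heq : {g | c.act g y = y} = {g | c.act g x = x} :=
        eq_of_subset_of_ncard_le hsub ((hexact x x.2).le.trans hy.2) (toFinite _)
      refine mem_iInter₂.1 hf' x hxs y ⟨hyW, fun g hg => ?_⟩
      exact (heq.symm ▸ hg : g ∈ {g | c.act g y = y})

theorem dense_nondegenerateSet [T2Space X] (hk : 2 ≤ k) {c : OrbifoldChart n X}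
    (hc : c ∈ 𝕏.atlas) {K : Set (EuclideanSpace ℝ (Fin n))} (hK : IsCompact K) (hKV : K ⊆ c.V) :
    Dense (𝕏.nondegenerateSet k c K) := by
  simpa using dense_nondegenerateSet_le_isotropyOrder (𝕏 := 𝕏) hk hc hK hKV (Nat.card c.Γ + 1) 0
    (by omega)

/-- Being Morse is a nondegeneracy condition on finitely many compact subsets of charts. -/
theorem exists_finset_isMorse_iff [CompactSpace X] (𝕏 : Orbifold n X) (hk : 2 ≤ k) :
    ∃ (s : Finset X) (c : X → OrbifoldChart n X) (K : X → Set (EuclideanSpace ℝ (Fin n))),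
      (∀ p, c p ∈ 𝕏.atlas ∧ IsCompact (K p) ∧ K p ⊆ (c p).V) ∧
      {f : 𝕏.CkFunction k | 𝕏.IsMorse f.toFun} = ⋂ p ∈ s, 𝕏.nondegenerateSet k (c p) (K p) := by
  have hex : ∀ p : X, ∃ (c : OrbifoldChart n X) (K : Set (EuclideanSpace ℝ (Fin n))),
      c ∈ 𝕏.atlas ∧ IsCompact K ∧ K ⊆ c.V ∧ c.φ '' K ∈ 𝓝 p := fun p => by
    obtain ⟨c, hc, x, hx, rfl⟩ := 𝕏.covers p
    obtain ⟨K, hK, hxK, hKV⟩ := exists_compact_subset c.isOpen_V hx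
    exact ⟨c, K, hc, hK, hKV, Filter.mem_of_superset ((c.φ_open _ (interior_subset.trans hKV)
      isOpen_interior).mem_nhds (mem_image_of_mem _ hxK)) (image_mono interior_subset)⟩
  choose c K hc hK hKV hnhds using hex
  obtain ⟨s, -, hs⟩ := isCompact_univ.elim_nhds_subcover (fun p => (c p).φ '' K p)
    fun p _ => hnhds p
  refine ⟨s, c, K, fun p => ⟨hc p, hK p, hKV p⟩, Subset.antisymm ?_ ?_⟩
  · intro f hf
    refine mem_iInter₂.2 fun p _ x hx => ?_
    exact (hf (c p) (atlas_subset_charts (hc p))).2 x (hKV p hx)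
  · intro f hf c' hc'
    refine ⟨(f.contDiffOn c' hc').of_le (by exact_mod_cast hk), fun y' hy' => ?_⟩
    obtain ⟨p, hp, y, hy, hyp⟩ := mem_iUnion₂.1 (hs (mem_univ (c'.φ y')))
    exact nondegenerateAt_of_nondegenerateAt_atlas hk f (hc p) hc' hy' (hKV p hy) hyp.symm
      (mem_iInter₂.1 hf p hp y hy)

end Orbifold

theorem mainTheorem6 {n : ℕ} {X : Type*} [TopologicalSpace X] [T2Space X] [CompactSpace X]
    (𝕏 : Orbifold n X) (k : ℕ) (hk : 2 ≤ k) :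
    IsOpen {f : 𝕏.CkFunction k | 𝕏.IsMorse f.toFun} ∧
      Dense {f : 𝕏.CkFunction k | 𝕏.IsMorse f.toFun} := by
  obtain ⟨s, c, K, hcK, heq⟩ := Orbifold.exists_finset_isMorse_iff 𝕏 hk
  have hopen : ∀ p ∈ s, IsOpen (𝕏.nondegenerateSet k (c p) (K p)) := fun p _ =>
    Orbifold.isOpen_nondegenerateSet hk (Orbifold.atlas_subset_charts (hcK p).1) (hcK p).2.1
      (hcK p).2.2
  rw [heq]
  exact ⟨isOpen_biInter_finset hopen, dense_biInter_finset_of_isOpen s hopen fun p _ =>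
    Orbifold.dense_nondegenerateSet hk (hcK p).1 (hcK p).2.1 (hcK p).2.2⟩
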